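/- Let $f=(f_1,\dots,f_N)$ be polynomials in $\mathbb C[x_1,\dots,x_n,\lambda_1,\dots,\lambda_m]$ and $\lambda^{(0)},\lambda^{(1)}\in\mathbb C^m$. The associated sweeping homotopy $h(x,\lambda,t)=0$ consists of the $N$ equations $f(x,\lambda)=0$ and the $m$ equations $(1-t)(\lambda-\lambda^{(0)})+t(\lambda-\lambda^{(1)})=0$; its components are denoted $h_k$. A solution $(x_*,\lambda_*)\in\mathbb C^n\times\mathbb C^m$ of $h(\cdot,\cdot,t_*)=0$ is called singular if the matrix $(\partial f_i/\partial x_j)$ has rank less than $n$ there. A solution path $(x(t),\lambda(t))$, defined for real $t$ near $t_*$ on one side of $t_*$ and converging to $(x_*,\lambda_*)$ as $t\to t_*$, has winding number $\omega\ge 1$ if $x(t)$ continues holomorphically along all curves in a punctured complex disc around $t_*$ and $\omega$ is the least positive number of loops around $t_*$ after which the continuation returns to its original value. Let $t_*\in[0,1]$, let $\omega\ge1$ be an integer, and let $t\to t_*$ from one fixed side, left or right. (1) Let a solution path $(x(t),\lambda(t))$ of a sweeping homotopy converge, as $t\to t_*$, to an isolated finite singular solution $(x_*,\lambda_*)$ at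 $t=t_*$, with winding number $\omega$. Let $y(t)$ be the path $x(t)$ itself or, more generally, any approximation of it with $y(t)-x(t)=O(|t-t_*|^{1/\omega})$. If for some component $k$ we have $h_k(y(t),\lambda(t),t)=O(t-t_*)$, then every partial derivative $\partial h_k/\partial x_j$ that vanishes at $(x_*,\lambda_*,t_*)$ satisfies $$\frac{\partial h_k}{\partial x_j}(y(t),\lambda(t),t)=O\big(|t-t_*|^{1/\omega}\big).$$ (2) This worst case occurs. For every $t_*$, side and $\omega$ as above there are a sweeping homotopy with $N=n$, an isolated finite singular solution $(x_*,\lambda_*)$ at $t_*$, a solution path $(x(t),\lambda(t))$ converging to it with winding number $\omega$, an approximation $y(t)=x(t)+O(t-t_*)$, and indices $k,j$, such that $\partial h_k/\partial x_j$ vanishes at $(x_*,\lambda_*,t_*)$ and is of exact order $|t-t_*|^{1/\omega}$ both along $x(t)$ and along $y(t)$, while $h_k(y(t),\lambda(t),t)$ is of exact order $|t-t_*|^{p}$ with $p=(\omega+1)/\omega$ (in particular it is $O(t-t_*)$), so that $1/\omega=p-1$. -/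

import Mathlib

open Filter Topology Asymptotics

namespace Sweep

/-- The variables `(x, lambda, t)` of a sweeping homotopy: `n` unknowns, `m` natural parameters
and the artificial parameter `t`. -/
abbrev Vars (n m : ℕ) : Type := Fin n ⊕ (Fin m ⊕ Unit)

/-- The point `(x, lambda, t)`. -/
def point {n m : ℕ} (x : Fin n → ℂ) (lam : Fin m → ℂ) (t : ℂ) : Vars n m → ℂ :=
  Sum.elim x (Sum.elim lam (fun _ => t))

/-- The sweeping homotopy of `f`, `lam0`, `lam1`: the `N` equations `f (x, lambda) = 0` followed by
the `m` equations `(1 - t) (lambda - lam0) + t (lambda - lam1) = 0`. -/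
noncomputable def homotopy {N n m : ℕ} (f : Fin N → MvPolynomial (Fin n ⊕ Fin m) ℂ)
    (lam0 lam1 : Fin m → ℂ) : Fin N ⊕ Fin m → MvPolynomial (Vars n m) ℂ
  | Sum.inl k => MvPolynomial.rename (Sum.map id Sum.inl) (f k)
  | Sum.inr i =>
      (1 - MvPolynomial.X (Sum.inr (Sum.inr ()))) *
          (MvPolynomial.X (Sum.inr (Sum.inl i)) - MvPolynomial.C (lam0 i)) +
        MvPolynomial.X (Sum.inr (Sum.inr ())) *
          (MvPolynomial.X (Sum.inr (Sum.inl i)) - MvPolynomial.C (lam1 i))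

/-- The Jacobian matrix `A`, with entries `∂ f_k / ∂ x_j`, at `(x, lambda)`. -/
noncomputable def jacobian {N n m : ℕ} (f : Fin N → MvPolynomial (Fin n ⊕ Fin m) ℂ)
    (x : Fin n → ℂ) (lam : Fin m → ℂ) : Matrix (Fin N) (Fin n) ℂ :=
  Matrix.of fun k j => MvPolynomial.eval (Sum.elim x lam) (MvPolynomial.pderiv (Sum.inl j) (f k))

/-- The value `h_k (x, lambda, t)`. -/
noncomputable def hval {N n m : ℕ} (f : Fin N → MvPolynomial (Fin n ⊕ Fin m) ℂ)
    (lam0 lam1 : Fin m → ℂ) (k : Fin N ⊕ Fin m) (x : Fin n → ℂ) (lam : Fin m → ℂ) (t : ℂ) : ℂ :=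
  MvPolynomial.eval (point x lam t) (homotopy f lam0 lam1 k)

/-- The value of the partial derivative `∂ h_k / ∂ x_j` at `(x, lambda, t)`. -/
noncomputable def dhval {N n m : ℕ} (f : Fin N → MvPolynomial (Fin n ⊕ Fin m) ℂ)
    (lam0 lam1 : Fin m → ℂ) (k : Fin N ⊕ Fin m) (j : Fin n)
    (x : Fin n → ℂ) (lam : Fin m → ℂ) (t : ℂ) : ℂ :=
  MvPolynomial.eval (point x lam t) (MvPolynomial.pderiv (Sum.inl j) (homotopy f lam0 lam1 k))

/-- `(xs, ls)` is an isolated finite singular solution of the sweeping homotopy at `t = ts`. -/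
structure IsIsolatedSingularSolution {N n m : ℕ} (f : Fin N → MvPolynomial (Fin n ⊕ Fin m) ℂ)
    (lam0 lam1 : Fin m → ℂ) (ts : ℝ) (xs : Fin n → ℂ) (ls : Fin m → ℂ) : Prop where
  solution : ∀ k, hval f lam0 lam1 k xs ls (ts : ℂ) = 0
  isolated : ∀ᶠ z : (Fin n → ℂ) × (Fin m → ℂ) in 𝓝 (xs, ls),
    (∀ k, hval f lam0 lam1 k z.1 z.2 (ts : ℂ) = 0) → z = (xs, ls)
  singular : (jacobian f xs ls).rank < n

/-- The real parameter values `t` tending to `ts` from the left (`σ = -1`) or from the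
right (`σ = 1`). -/
def side (σ ts : ℝ) : Filter ℝ := 𝓝[{t : ℝ | 0 < σ * (t - ts)}] ts

/-- `(x t, lam t)` is a solution path of the sweeping homotopy for `t` near `ts` on the given side,
and it ends in (or starts from) the point `(xs, ls)` at `t = ts`. -/
structure IsSolutionPath {N n m : ℕ} (f : Fin N → MvPolynomial (Fin n ⊕ Fin m) ℂ)
    (lam0 lam1 : Fin m → ℂ) (σ ts : ℝ) (x : ℝ → Fin n → ℂ) (lam : ℝ → Fin m → ℂ)
    (xs : Fin n → ℂ) (ls : Fin m → ℂ) : Prop where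
  solves : ∀ᶠ t in side σ ts, ∀ k, hval f lam0 lam1 k (x t) (lam t) (t : ℂ) = 0
  tendsto_x : Tendsto x (side σ ts) (𝓝 xs)
  tendsto_lam : Tendsto lam (side σ ts) (𝓝 ls)

/-- The path `x` has winding number `ω` at `ts`. In the logarithmic coordinate `u`, with
`t = ts + σ * exp u`, the path has a holomorphic continuation `Z` along all curves in a punctured
disc around `ts`, and `ω` is the least positive number of loops around `ts` after which the
continuation returns to its original value. -/
def HasWindingNumber {n : ℕ} (σ ts : ℝ) (x : ℝ → Fin n → ℂ) (ω : ℕ) : Prop :=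
  ∃ (R : ℝ) (Z : ℂ → Fin n → ℂ),
    DifferentiableOn ℂ Z {u : ℂ | u.re < R} ∧
    (∀ r : ℝ, r < R → Z (r : ℂ) = x (ts + σ * Real.exp r)) ∧
    IsLeast {c : ℕ | 0 < c ∧
      ∀ u : ℂ, u.re < R → Z (u + (c : ℂ) * (2 * (Real.pi : ℂ) * Complex.I)) = Z u} ω

end Sweep

namespace Sweep

/-! Write `t = ts + σ * exp u`. The path continues to a holomorphic `Z` on a left half-plane, with
period `2πiω`. By the identity theorem `Z` solves the homotopy everywhere (`continuation_solves`).
Isolation and compactness keep solutions off a small sphere around `xs` for `t` near `ts`, so `Z`,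
which enters the ball, cannot leave it (`continuation_bounded`). A bounded function of `exp (u / ω)`
has a removable singularity, whence `x t - xs = O(|t - ts| ^ (1 / ω))` (`isBigO_exp_of_periodic`).
The parameter is affine in `t`, and a polynomial vanishing at the endpoint is Lipschitz there, which
bounds the derivative.

For sharpness take `x₀ ^ ω = s`, `x₁ (x₀ + x₁) = 0` with `s = σ (t - ts)`. The path is `(s ^ (1 /
ω), 0)`, and `y` replaces its second entry by `s`. The second equation then has value `s ^ (1 / ω) *
s + s ^ 2` and `x₁`-derivative `s ^ (1 / ω) + 2 s`. -/

lemma tendsto_exp_side {σ ts : ℝ} (hσ : σ = 1 ∨ σ = -1) :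
    Tendsto (fun r : ℝ => ts + σ * Real.exp r) atBot (side σ ts) := by
  refine tendsto_nhdsWithin_iff.2 ⟨?_, Eventually.of_forall fun r => ?_⟩
  · simpa using (Real.tendsto_exp_atBot.const_mul σ).const_add ts
  · have := Real.exp_pos r
    rcases hσ with rfl | rfl <;> simpa using this

lemma eventually_side_pos (σ ts : ℝ) : ∀ᶠ t in side σ ts, 0 < σ * (t - ts) :=
  eventually_mem_nhdsWithin

lemma tendsto_mul_sub_side (σ ts : ℝ) :
    Tendsto (fun t => σ * (t - ts)) (side σ ts) (𝓝[>] 0) := by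
  refine tendsto_nhdsWithin_iff.2 ⟨?_, eventually_side_pos σ ts⟩
  have : Continuous fun t : ℝ => σ * (t - ts) := by fun_prop
  have h0 : Tendsto (fun t : ℝ => σ * (t - ts)) (𝓝 ts) (𝓝 0) := by simpa using this.tendsto ts
  exact h0.mono_left nhdsWithin_le_nhds

lemma tendsto_log_side (σ ts : ℝ) :
    Tendsto (fun t => Real.log (σ * (t - ts))) (side σ ts) atBot :=
  Real.tendsto_log_nhdsGT_zero.comp (tendsto_mul_sub_side σ ts)

lemma abs_sub_eq_mul {σ t ts : ℝ} (hσ : σ = 1 ∨ σ = -1) (h : 0 < σ * (t - ts)) :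
    |t - ts| = σ * (t - ts) := by
  rcases hσ with rfl | rfl
  · rw [abs_of_pos] <;> linarith
  · rw [abs_of_neg] <;> linarith

/-- The parameter value `lam` on which the last equations of the homotopy vanish at `t`. -/
def paramLine {m : ℕ} (lam0 lam1 : Fin m → ℂ) (t : ℂ) : Fin m → ℂ :=
  fun i => lam0 i + t * (lam1 i - lam0 i)

lemma continuous_paramLine {m : ℕ} (lam0 lam1 : Fin m → ℂ) :
    Continuous (paramLine lam0 lam1) := by
  unfold paramLine; fun_prop

lemma continuous_point {α : Type*} [TopologicalSpace α] {n m : ℕ} {x : α → Fin n → ℂ}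
    {lam : α → Fin m → ℂ} {t : α → ℂ} (hx : Continuous x) (hl : Continuous lam)
    (ht : Continuous t) : Continuous fun a => point (x a) (lam a) (t a) := by
  refine continuous_pi fun i => ?_
  rcases i with i | i | i <;> simp only [point, Sum.elim_inl, Sum.elim_inr] <;> fun_prop

section
variable {N n m : ℕ} {f : Fin N → MvPolynomial (Fin n ⊕ Fin m) ℂ} {lam0 lam1 : Fin m → ℂ}

lemma hval_inr (i : Fin m) (x : Fin n → ℂ) (lam : Fin m → ℂ) (t : ℂ) :
    hval f lam0 lam1 (Sum.inr i) x lam t = lam i - paramLine lam0 lam1 t i := by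
  simp [hval, homotopy, point, paramLine]
  ring

/-- The last `m` equations are affine in the parameter with leading coefficient `1`, so `t`
determines it and only `x` remains unknown. -/
lemma eq_paramLine {x : Fin n → ℂ} {lam : Fin m → ℂ} {t : ℂ}
    (h : ∀ k, hval f lam0 lam1 k x lam t = 0) : lam = paramLine lam0 lam1 t := by
  funext i
  simpa [hval_inr, sub_eq_zero] using h (Sum.inr i)

lemma continuous_hval_paramLine (k : Fin N ⊕ Fin m) :
    Continuous fun z : ℂ × (Fin n → ℂ) =>
      hval f lam0 lam1 k z.2 (paramLine lam0 lam1 z.1) z.1 :=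
  (MvPolynomial.continuous_eval (homotopy f lam0 lam1 k)).comp
    (continuous_point continuous_snd ((continuous_paramLine lam0 lam1).comp continuous_fst)
      continuous_fst)

/-! ### Trapping the continued path near an isolated solution -/

/-- Near an isolated solution, all solutions with a parameter value near `ts` avoid a
small sphere around it. -/
lemma exists_sphere_avoids {ts : ℝ} {xs : Fin n → ℂ} {ls : Fin m → ℂ}
    (h : IsIsolatedSingularSolution f lam0 lam1 ts xs ls) :
    ∃ ε > 0, ∀ᶠ t : ℂ in 𝓝 (ts : ℂ), ∀ x ∈ Metric.sphere xs ε,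
      ¬ ∀ k, hval f lam0 lam1 k x (paramLine lam0 lam1 t) t = 0 := by
  have hls := eq_paramLine h.solution
  obtain ⟨δ, hδ, hball⟩ := Metric.eventually_nhds_iff.1 h.isolated
  -- Half the isolation radius keeps the closed sphere inside the open ball of radius `δ`.
  refine ⟨δ / 2, by positivity, ?_⟩
  refine (isCompact_sphere xs (δ / 2)).eventually_forall_of_forall_eventually
    (P := fun t x => ¬ ∀ k, hval f lam0 lam1 k x (paramLine lam0 lam1 t) t = 0) ?_
  intro x hx
  have hne : ¬ ∀ k, hval f lam0 lam1 k x (paramLine lam0 lam1 ts) ts = 0 := by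
    intro hk
    rw [Metric.mem_sphere] at hx
    rw [← hls] at hk
    have hxs : x = xs :=
      congrArg Prod.fst (hball (y := (x, ls)) (by simp [Prod.dist_eq, hx, hδ]) hk)
    rw [hxs, dist_self] at hx
    linarith
  obtain ⟨k, hk⟩ := not_forall.1 hne
  have hc : ContinuousAt (fun z : ℂ × (Fin n → ℂ) =>
      hval f lam0 lam1 k z.2 (paramLine lam0 lam1 z.1) z.1) ((ts : ℂ), x) :=
    (continuous_hval_paramLine k).continuousAt
  exact (hc.eventually_ne hk).mono fun z hz hall => hz (hall k)

/-- The continuation of a solution path solves the homotopy on the whole half-plane. -/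
lemma continuation_solves {σ ts R : ℝ} (hσ : σ = 1 ∨ σ = -1) {x : ℝ → Fin n → ℂ}
    {lam : ℝ → Fin m → ℂ} {xs : Fin n → ℂ} {ls : Fin m → ℂ}
    (h : IsSolutionPath f lam0 lam1 σ ts x lam xs ls) {Z : ℂ → Fin n → ℂ}
    (hZ : DifferentiableOn ℂ Z {u : ℂ | u.re < R})
    (hx : ∀ r : ℝ, r < R → Z (r : ℂ) = x (ts + σ * Real.exp r)) {u : ℂ} (hu : u.re < R)
    (k : Fin N ⊕ Fin m) :
    hval f lam0 lam1 k (Z u) (paramLine lam0 lam1 (ts + σ * Complex.exp u))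
      (ts + σ * Complex.exp u) = 0 := by
  have hopen : IsOpen {u : ℂ | u.re < R} := isOpen_lt Complex.continuous_re continuous_const
  have hZa : ∀ j, AnalyticOnNhd ℂ (fun u => Z u j) {u : ℂ | u.re < R} := fun j =>
    DifferentiableOn.analyticOnNhd (fun u hu => differentiableWithinAt_pi.1 (hZ u hu) j) hopen
  have hta : AnalyticOnNhd ℂ (fun u : ℂ => (ts : ℂ) + σ * Complex.exp u) {u : ℂ | u.re < R} :=
    DifferentiableOn.analyticOnNhd (by fun_prop) hopen
  have hla : ∀ i, AnalyticOnNhd ℂ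
      (fun u : ℂ => paramLine lam0 lam1 ((ts : ℂ) + σ * Complex.exp u) i) {u : ℂ | u.re < R} :=
    fun i => DifferentiableOn.analyticOnNhd (by unfold paramLine; fun_prop) hopen
  have hF : AnalyticOnNhd ℂ (fun u => hval f lam0 lam1 k (Z u)
      (paramLine lam0 lam1 (ts + σ * Complex.exp u)) (ts + σ * Complex.exp u))
      {u : ℂ | u.re < R} := by
    refine AnalyticOnNhd.aeval_mvPolynomial (A := ℂ) (f := fun u => point (Z u)
      (paramLine lam0 lam1 (ts + σ * Complex.exp u)) (ts + σ * Complex.exp u)) ?_ _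
    rintro (j | i | i)
    exacts [hZa j, hla i, hta]
  obtain ⟨r₀, hr₀⟩ := eventually_atBot.1 ((tendsto_exp_side hσ).eventually h.solves)
  set r₁ := min r₀ R - 1 with hr₁
  have hr₁0 : r₁ < r₀ := by have := min_le_left r₀ R; linarith
  have hr₁R : r₁ < R := by have := min_le_right r₀ R; linarith
  -- The equation holds at real points accumulating at `r₁`, which suffices for the identity
  -- theorem.
  refine hF.eqOn_zero_of_preconnected_of_frequently_eq_zero (z₀ := (r₁ : ℂ))
    (convex_halfSpace_re_lt R).isPreconnected (by simpa using hr₁R) ?_ hu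
  have hcast : Tendsto (fun r : ℝ => (r : ℂ)) (𝓝[≠] r₁) (𝓝[≠] (r₁ : ℂ)) :=
    Complex.continuous_ofReal.continuousWithinAt.tendsto_nhdsWithin fun r hr => by
      simpa using hr
  refine hcast.frequently (Eventually.frequently ?_)
  filter_upwards [nhdsWithin_le_nhds (eventually_lt_nhds hr₁0),
    nhdsWithin_le_nhds (eventually_lt_nhds hr₁R)] with r h0 hR
  have hs := hr₀ r h0.le
  have := hs k
  rw [eq_paramLine hs, ← hx r hR] at this
  simpa using this

/-- The continuation of a solution path stays bounded near an isolated solution. -/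
lemma continuation_bounded {σ ts R : ℝ} (hσ : σ = 1 ∨ σ = -1) {x : ℝ → Fin n → ℂ}
    {lam : ℝ → Fin m → ℂ} {xs : Fin n → ℂ} {ls : Fin m → ℂ}
    (hs : IsIsolatedSingularSolution f lam0 lam1 ts xs ls)
    (h : IsSolutionPath f lam0 lam1 σ ts x lam xs ls) {Z : ℂ → Fin n → ℂ}
    (hZ : DifferentiableOn ℂ Z {u : ℂ | u.re < R})
    (hx : ∀ r : ℝ, r < R → Z (r : ℂ) = x (ts + σ * Real.exp r)) :
    ∃ R' ≤ R, ∃ ε, ∀ u : ℂ, u.re < R' → dist (Z u) xs < ε := by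
  obtain ⟨ε, hε, hav⟩ := exists_sphere_avoids hs
  obtain ⟨δ, hδ, hball⟩ := Metric.eventually_nhds_iff.1 hav
  obtain ⟨r₀, hr₀⟩ := eventually_atBot.1
    ((h.tendsto_x.comp (tendsto_exp_side hσ)).eventually (Metric.ball_mem_nhds xs hε))
  -- Since `|t - ts| = exp u.re`, the bound `log δ` keeps `t` where the sphere carries no solution.
  set R' := min R (Real.log δ)
  refine ⟨R', min_le_left _ _, ε, fun u hu => ?_⟩
  by_contra! hge
  set r := min r₀ (R' - 1)
  have hrR' : r < R' := by have := min_le_right r₀ (R' - 1); linarith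
  have hrR : r < R := hrR'.trans_le (min_le_left _ _)
  have hcont : ContinuousOn (fun u => dist (Z u) xs) {u : ℂ | u.re < R'} :=
    (continuous_id.dist continuous_const).comp_continuousOn
      (hZ.continuousOn.mono fun v (hv : v.re < R') => hv.trans_le (min_le_left _ _))
  have hlt : dist (Z r) xs < ε := by
    rw [hx r hrR]
    exact hr₀ r (min_le_left _ _)
  -- The half-plane is connected, so leaving the ball would put some `Z v` on the sphere.
  obtain ⟨v, hv, hveq⟩ := (convex_halfSpace_re_lt R').isPreconnected.intermediate_value
    (a := (r : ℂ)) (b := u) (by simpa using hrR') hu hcont ⟨hlt.le, hge⟩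
  refine hball (y := ts + σ * Complex.exp v) ?_ (Z v) hveq fun k =>
    continuation_solves hσ h hZ hx (lt_of_lt_of_le hv (min_le_left _ _)) k
  have hσn : ‖(σ : ℂ)‖ = 1 := by rcases hσ with rfl | rfl <;> simp
  rw [dist_eq_norm, add_sub_cancel_left, norm_mul, hσn, one_mul, Complex.norm_exp]
  calc Real.exp v.re < Real.exp (Real.log δ) :=
        Real.exp_lt_exp.2 (lt_of_lt_of_le hv (min_le_right _ _))
    _ = δ := Real.exp_log hδ

end

/-! ### Removable singularity on the `ω`-fold cover -/

/-- A bounded holomorphic function on a left half-plane with period `2 π i ω` approaches its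
limit at `-∞` at the rate `exp (r / ω)`. -/
lemma isBigO_exp_of_periodic {ω : ℕ} (hω : 1 ≤ ω) {R C : ℝ} {F : ℂ → ℂ} {a : ℂ}
    (hF : DifferentiableOn ℂ F {u : ℂ | u.re < R})
    (hper : ∀ u : ℂ, u.re < R → F (u + (ω : ℂ) * (2 * (Real.pi : ℂ) * Complex.I)) = F u)
    (hbd : ∀ u : ℂ, u.re < R → ‖F u‖ ≤ C)
    (hlim : Tendsto (fun r : ℝ => F r) atBot (𝓝 a)) :
    (fun r : ℝ => F r - a) =O[atBot] fun r => Real.exp (r / ω) := by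
  have hω0 : 0 < (ω : ℝ) := by exact_mod_cast hω
  set h : ℝ := 2 * Real.pi * ω with hh
  have hpos : 0 < h := by positivity
  -- With `u = I * z` the left half-plane becomes an upper one and the period becomes the real
  -- number `h`. Extension by zero makes the periodicity global.
  set G : ℂ → ℂ := fun z => if (Complex.I * z).re < R then F (Complex.I * z) else 0 with hG
  have hGper : Function.Periodic G h := fun z => by
    have h1 : Complex.I * (z + h) =
        Complex.I * z + (ω : ℂ) * (2 * (Real.pi : ℂ) * Complex.I) := by
      rw [hh]; push_cast; ring
    have h2 : (Complex.I * (z + h)).re = (Complex.I * z).re := by simp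
    simp only [hG, h2]
    split_ifs with hz
    · rw [h1, hper _ hz]
    · rfl
  have hev : ∀ᶠ z in comap Complex.im atTop, (Complex.I * z).re < R := by
    filter_upwards [tendsto_comap.eventually (eventually_gt_atTop (-R))] with z hz
    simp only [Complex.mul_re, Complex.I_re, Complex.I_im]
    linarith
  have hopen : IsOpen {z : ℂ | (Complex.I * z).re < R} :=
    isOpen_lt (by fun_prop) continuous_const
  have hol : ∀ᶠ z in comap Complex.im atTop, DifferentiableAt ℂ G z := by
    filter_upwards [hev] with z hz
    have hd : DifferentiableAt ℂ F (Complex.I * z) := hF.differentiableAt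
      ((isOpen_lt Complex.continuous_re continuous_const).mem_nhds hz)
    refine (DifferentiableAt.comp z hd
      (differentiableAt_id.const_mul Complex.I)).congr_of_eventuallyEq ?_
    filter_upwards [hopen.mem_nhds hz] with w hw
    exact if_pos hw
  have hGbd : BoundedAtFilter (comap Complex.im atTop) G := by
    refine IsBigO.of_bound C ?_
    filter_upwards [hev] with z hz
    simp only [hG, if_pos hz, Pi.one_apply, norm_one, mul_one]
    exact hbd _ hz
  have hcurve : Tendsto (fun r : ℝ => -Complex.I * (r : ℂ)) atBot (comap Complex.im atTop) := by
    refine tendsto_comap_iff.2 ?_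
    simpa [Function.comp_def] using tendsto_neg_atBot_atTop
  have hGF : ∀ᶠ r : ℝ in atBot, G (-Complex.I * r) = F r := by
    filter_upwards [eventually_lt_atBot R] with r hr
    have h1 : Complex.I * (-Complex.I * r) = r := by
      rw [← mul_assoc, mul_neg, Complex.I_mul_I, neg_neg, one_mul]
    simp only [hG, h1, Complex.ofReal_re, if_pos hr]
  have hval : Function.Periodic.cuspFunction h G 0 = a := by
    refine tendsto_nhds_unique ?_ hlim
    exact ((Function.Periodic.tendsto_at_I_inf hpos hGper hol hGbd).comp hcurve).congr' hGF
  -- The decay rate is `exp (-2π Im z / h)`; along `z = -I * r` this is `exp (r / ω)`.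
  have key := (Function.Periodic.exp_decay_sub_of_bounded_at_inf hpos hGper hol hGbd).comp_tendsto
    hcurve
  rw [hval] at key
  refine key.congr' (hGF.mono fun r hr => by simp only [Function.comp_apply, hr])
    (Eventually.of_forall fun r => ?_)
  simp only [Function.comp_apply]
  congr 1
  rw [hh]
  simp
  field_simp

section
variable {N n m : ℕ} {f : Fin N → MvPolynomial (Fin n ⊕ Fin m) ℂ} {lam0 lam1 : Fin m → ℂ}

/-- A solution path of winding number `ω` is Hölder of exponent `1 / ω` at its end. -/
lemma solutionPath_sub_isBigO {σ ts : ℝ} (hσ : σ = 1 ∨ σ = -1) {ω : ℕ} (hω : 1 ≤ ω)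
    {x : ℝ → Fin n → ℂ} {lam : ℝ → Fin m → ℂ} {xs : Fin n → ℂ} {ls : Fin m → ℂ}
    (hs : IsIsolatedSingularSolution f lam0 lam1 ts xs ls)
    (h : IsSolutionPath f lam0 lam1 σ ts x lam xs ls) (hw : HasWindingNumber σ ts x ω) :
    (fun t => x t - xs) =O[side σ ts] fun t => |t - ts| ^ (1 / (ω : ℝ)) := by
  obtain ⟨R, Z, hZ, hx, ⟨-, hper⟩, -⟩ := hw
  obtain ⟨R', hR', ε, hε⟩ := continuation_bounded hσ hs h hZ hx
  have hZx : ∀ᶠ r : ℝ in atBot, x (ts + σ * Real.exp r) = Z r :=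
    (eventually_lt_atBot R).mono fun r hr => (hx r hr).symm
  have hlim : Tendsto (fun r : ℝ => Z r) atBot (𝓝 xs) :=
    (h.tendsto_x.comp (tendsto_exp_side hσ)).congr' hZx
  refine isBigO_pi.2 fun j => ?_
  have key : (fun r : ℝ => Z r j - xs j) =O[atBot] fun r => Real.exp (r / ω) := by
    refine isBigO_exp_of_periodic hω (R := R') (C := ε + ‖xs‖) (F := fun u => Z u j)
      (fun u hu => (differentiableWithinAt_pi.1 (hZ u (hu.trans_le hR')) j).mono
        fun v hv => lt_of_lt_of_le hv hR')
      (fun u hu => congrFun (hper u (hu.trans_le hR')) j) (fun u hu => ?_)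
      (tendsto_pi_nhds.1 hlim j)
    calc ‖Z u j‖ ≤ ‖Z u‖ := norm_le_pi_norm _ _
      _ = ‖(Z u - xs) + xs‖ := by rw [sub_add_cancel]
      _ ≤ ‖Z u - xs‖ + ‖xs‖ := norm_add_le _ _
      _ ≤ ε + ‖xs‖ := by
        have := hε u hu
        rw [dist_eq_norm] at this
        linarith
  refine (key.comp_tendsto (tendsto_log_side σ ts)).congr' ?_ ?_
  · filter_upwards [eventually_side_pos σ ts,
      (tendsto_log_side σ ts).eventually (eventually_lt_atBot R)] with t hpos hR
    have h1 : ts + σ * (σ * (t - ts)) = t := by rcases hσ with rfl | rfl <;> ring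
    simp only [Function.comp_apply, hx _ hR, Real.exp_log hpos, h1, Pi.sub_apply]
  · filter_upwards [eventually_side_pos σ ts] with t hpos
    rw [abs_sub_eq_mul hσ hpos, Real.rpow_def_of_pos hpos, Function.comp_apply, mul_one_div]

/-! ### Transfer of the rate to the partial derivatives -/

lemma sub_isBigO_rpow (σ ts : ℝ) {ω : ℕ} (hω : 1 ≤ ω) :
    (fun t : ℝ => t - ts) =O[side σ ts] fun t => |t - ts| ^ (1 / (ω : ℝ)) := by
  have h1 : ∀ᶠ t in side σ ts, |t - ts| < 1 := by
    refine nhdsWithin_le_nhds ?_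
    filter_upwards [Metric.ball_mem_nhds ts one_pos] with t ht
    simpa [Real.dist_eq] using ht
  refine IsBigO.of_bound 1 (h1.mono fun t ht => ?_)
  rw [one_mul, Real.norm_eq_abs, Real.norm_of_nonneg (by positivity)]
  refine Real.self_le_rpow_of_le_one (abs_nonneg _) ht.le ?_
  rw [div_le_one (by exact_mod_cast hω)]
  exact_mod_cast hω

lemma tendsto_abs_sub_rpow (σ ts : ℝ) {ω : ℕ} (hω : 1 ≤ ω) :
    Tendsto (fun t => |t - ts| ^ (1 / (ω : ℝ))) (side σ ts) (𝓝 0) := by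
  have hpos : 0 < 1 / (ω : ℝ) := by
    have : 0 < (ω : ℝ) := by exact_mod_cast hω
    positivity
  have hc : Continuous fun t : ℝ => |t - ts| ^ (1 / (ω : ℝ)) :=
    (by fun_prop : Continuous fun t : ℝ => |t - ts|).rpow_const fun _ => Or.inr hpos.le
  have h0 : Tendsto (fun t : ℝ => |t - ts| ^ (1 / (ω : ℝ))) (𝓝 ts) (𝓝 0) := by
    have := hc.tendsto ts
    rwa [sub_self, abs_zero, Real.zero_rpow hpos.ne'] at this
  exact h0.mono_left nhdsWithin_le_nhds

lemma solutionPath_lam_sub_isBigO {σ ts : ℝ} {x : ℝ → Fin n → ℂ} {lam : ℝ → Fin m → ℂ}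
    {xs : Fin n → ℂ} {ls : Fin m → ℂ}
    (hs : IsIsolatedSingularSolution f lam0 lam1 ts xs ls)
    (h : IsSolutionPath f lam0 lam1 σ ts x lam xs ls) :
    (fun t => lam t - ls) =O[side σ ts] fun t : ℝ => t - ts := by
  refine isBigO_pi.2 fun i => IsBigO.of_bound ‖lam1 i - lam0 i‖ (h.solves.mono fun t ht => ?_)
  rw [eq_paramLine ht, eq_paramLine hs.solution]
  have : (paramLine lam0 lam1 t - paramLine lam0 lam1 ts) i
      = (lam1 i - lam0 i) * ((t - ts : ℝ) : ℂ) := by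
    simp only [paramLine, Pi.sub_apply]; push_cast; ring
  rw [this, norm_mul, Complex.norm_real]

/-- Differentiability at `p₀` gives a linear bound there; `g → 0` ensures that `p` tends to `p₀`. -/
lemma eval_sub_isBigO {ι : Type*} [Fintype ι] {α : Type*} {l : Filter α} {p : α → ι → ℂ}
    {p₀ : ι → ℂ} {g : α → ℝ} (hp : (fun a => p a - p₀) =O[l] g) (hg : Tendsto g l (𝓝 0))
    (Q : MvPolynomial ι ℂ) :
    (fun a => MvPolynomial.eval (p a) Q - MvPolynomial.eval p₀ Q) =O[l] g := by
  have hd : DifferentiableAt ℂ (fun q : ι → ℂ => MvPolynomial.eval q Q) p₀ :=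
    (AnalyticAt.aeval_mvPolynomial (A := ℂ) (f := fun q : ι → ℂ => q)
      (fun i => (ContinuousLinearMap.proj (R := ℂ) (φ := fun _ : ι => ℂ) i).analyticAt p₀)
      Q).differentiableAt
  have ht : Tendsto p l (𝓝 p₀) := tendsto_sub_nhds_zero_iff.1 (hp.trans_tendsto hg)
  exact (hd.isBigO_sub.comp_tendsto ht).trans hp

lemma dhval_isBigO {σ ts : ℝ} (hσ : σ = 1 ∨ σ = -1) {ω : ℕ} (hω : 1 ≤ ω)
    {x y : ℝ → Fin n → ℂ} {lam : ℝ → Fin m → ℂ} {xs : Fin n → ℂ} {ls : Fin m → ℂ}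
    (hs : IsIsolatedSingularSolution f lam0 lam1 ts xs ls)
    (h : IsSolutionPath f lam0 lam1 σ ts x lam xs ls) (hw : HasWindingNumber σ ts x ω)
    (hy : (fun t => y t - x t) =O[side σ ts] fun t => |t - ts| ^ (1 / (ω : ℝ)))
    (k : Fin N ⊕ Fin m) (j : Fin n) (h0 : dhval f lam0 lam1 k j xs ls (ts : ℂ) = 0) :
    (fun t => dhval f lam0 lam1 k j (y t) (lam t) (t : ℂ)) =O[side σ ts]
      fun t => |t - ts| ^ (1 / (ω : ℝ)) := by
  have hyx : (fun t => y t - xs) =O[side σ ts] fun t => |t - ts| ^ (1 / (ω : ℝ)) :=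
    (hy.add (solutionPath_sub_isBigO hσ hω hs h hw)).congr_left fun t => by simp
  have hl := (solutionPath_lam_sub_isBigO hs h).trans (sub_isBigO_rpow σ ts hω)
  have hp : (fun t : ℝ => point (y t) (lam t) (t : ℂ) - point xs ls (ts : ℂ)) =O[side σ ts]
      fun t => |t - ts| ^ (1 / (ω : ℝ)) := by
    refine isBigO_pi.2 ?_
    rintro (i | i | i)
    · exact isBigO_pi.1 hyx i
    · exact isBigO_pi.1 hl i
    · refine IsBigO.trans (IsBigO.of_bound 1 (Eventually.of_forall fun t => ?_))
        (sub_isBigO_rpow σ ts hω)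
      simp [point, ← Complex.ofReal_sub]
  refine (eval_sub_isBigO hp (tendsto_abs_sub_rpow σ ts hω)
    (MvPolynomial.pderiv (Sum.inl j) (homotopy f lam0 lam1 k))).congr_left fun t => ?_
  exact (congrArg _ h0).trans (sub_zero _)

end

/-! ### The worst case -/

/-- The system `x₀ ^ ω = lam`, `x₀ x₁ + x₁ ^ 2 = 0`. -/
noncomputable def branchSystem (ω : ℕ) : Fin 2 → MvPolynomial (Fin 2 ⊕ Fin 1) ℂ :=
  ![MvPolynomial.X (Sum.inl 0) ^ ω - MvPolynomial.X (Sum.inr 0),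
    MvPolynomial.X (Sum.inl 0) * MvPolynomial.X (Sum.inl 1) + MvPolynomial.X (Sum.inl 1) ^ 2]

lemma hval_branchSystem_zero (ω : ℕ) (lam0 lam1 lam : Fin 1 → ℂ) (x : Fin 2 → ℂ) (t : ℂ) :
    hval (branchSystem ω) lam0 lam1 (Sum.inl 0) x lam t = x 0 ^ ω - lam 0 := by
  simp [hval, homotopy, branchSystem, point]

lemma hval_branchSystem_one (ω : ℕ) (lam0 lam1 lam : Fin 1 → ℂ) (x : Fin 2 → ℂ) (t : ℂ) :
    hval (branchSystem ω) lam0 lam1 (Sum.inl 1) x lam t = x 0 * x 1 + x 1 ^ 2 := by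
  simp [hval, homotopy, branchSystem, point]

lemma dhval_branchSystem (ω : ℕ) (lam0 lam1 lam : Fin 1 → ℂ) (x : Fin 2 → ℂ) (t : ℂ) :
    dhval (branchSystem ω) lam0 lam1 (Sum.inl 1) 1 x lam t = x 0 + 2 * x 1 := by
  simp [dhval, homotopy, branchSystem, point, MvPolynomial.pderiv_X]

lemma jacobian_branchSystem_rank (ω : ℕ) (lam : Fin 1 → ℂ) :
    (jacobian (branchSystem ω) 0 lam).rank < 2 := by
  -- The second row `(x₁, x₀ + 2 x₁)` vanishes at the origin, leaving an outer product of rank at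
  -- most one, even when `ω = 1`.
  have h : jacobian (branchSystem ω) 0 lam =
      Matrix.vecMulVec ![1, 0] (jacobian (branchSystem ω) 0 lam 0) := by
    ext i j
    fin_cases i
    · simp [Matrix.vecMulVec_apply]
    · simp [Matrix.vecMulVec_apply, jacobian, branchSystem]
  rw [h]
  exact (Matrix.rank_vecMulVec_le _ _).trans_lt one_lt_two

/-- The branch `(s ^ (1 / ω), b s)` with `s = σ (t - ts)`. -/
noncomputable def branchPath (σ ts b : ℝ) (ω : ℕ) (t : ℝ) : Fin 2 → ℂ :=
  ![(((σ * (t - ts)) ^ (1 / (ω : ℝ)) : ℝ) : ℂ), ((b * (σ * (t - ts)) : ℝ) : ℂ)]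

lemma tendsto_branchPath (σ ts b : ℝ) {ω : ℕ} (hω : 1 ≤ ω) :
    Tendsto (branchPath σ ts b ω) (side σ ts) (𝓝 0) := by
  have hs : Tendsto (fun t => σ * (t - ts)) (side σ ts) (𝓝 0) :=
    (tendsto_mul_sub_side σ ts).mono_right nhdsWithin_le_nhds
  have hpos : 0 < 1 / (ω : ℝ) := by
    have : 0 < (ω : ℝ) := by exact_mod_cast hω
    positivity
  have hroot := hs.rpow_const (p := 1 / (ω : ℝ)) (Or.inr hpos.le)
  rw [Real.zero_rpow hpos.ne'] at hroot
  refine tendsto_pi_nhds.2 fun j => ?_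
  fin_cases j
  · simpa [branchPath, Function.comp_def] using
      (Complex.continuous_ofReal.tendsto 0).comp hroot
  · have := (Complex.continuous_ofReal.tendsto 0).comp
      (by simpa using hs.const_mul b)
    simpa [branchPath, Function.comp_def] using this

lemma branchPath_hasWindingNumber (ts : ℝ) {σ : ℝ} (hσ : σ = 1 ∨ σ = -1) {ω : ℕ} (hω : 1 ≤ ω) :
    HasWindingNumber σ ts (branchPath σ ts 0 ω) ω := by
  have hω0 : (ω : ℂ) ≠ 0 := by exact_mod_cast (by omega : ω ≠ 0)
  refine ⟨0, fun u => ![Complex.exp (u / ω), 0], ?_, fun r _ => ?_, ⟨hω, fun u _ => ?_⟩, ?_⟩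
  · refine differentiableOn_pi.2 fun j => ?_
    fin_cases j
    · simp; fun_prop
    · simp
  · have h1 : σ * (ts + σ * Real.exp r - ts) = Real.exp r := by
      rcases hσ with rfl | rfl <;> ring
    rw [branchPath, h1, ← Real.exp_mul]
    simp [div_eq_mul_inv]
  · have : (u + ω * (2 * Real.pi * Complex.I)) / ω = u / ω + 2 * Real.pi * Complex.I := by
      field_simp
    simp only [this, Complex.exp_periodic (u / ω)]
  · rintro c ⟨hc, h⟩
    -- One point of the half-plane suffices: equal exponentials there force `c / ω` to be an
    -- integer.
    have h1 := congrFun (h (-1 : ℂ) (by simp)) 0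
    simp only [Matrix.cons_val_zero] at h1
    obtain ⟨k, hk⟩ := Complex.exp_eq_exp_iff_exists_int.1 h1
    have hpi : (2 * Real.pi * Complex.I : ℂ) ≠ 0 := Complex.two_pi_I_ne_zero
    have h2 : (c : ℂ) * (2 * Real.pi * Complex.I) = (k * ω : ℂ) * (2 * Real.pi * Complex.I) := by
      field_simp at hk
      linear_combination hk
    have h3 : (c : ℤ) = k * ω := by exact_mod_cast mul_right_cancel₀ hpi h2
    exact Nat.le_of_dvd hc (Int.natCast_dvd_natCast.1 ⟨k, by rw [h3, mul_comm]⟩)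

/-- A real function squeezed between positive multiples of `|t - ts| ^ p` is of that exact
order. -/
lemma isTheta_of_bounds {σ ts p C : ℝ} (hσ : σ = 1 ∨ σ = -1) {g : ℝ → ℂ} {a : ℝ → ℝ}
    (hg : ∀ t, g t = (a t : ℂ))
    (h : ∀ᶠ t in side σ ts, (σ * (t - ts)) ^ p ≤ a t ∧ a t ≤ C * (σ * (t - ts)) ^ p) :
    g =Θ[side σ ts] fun t => |t - ts| ^ p := by
  constructor
  · refine IsBigO.of_bound C ?_
    filter_upwards [h, eventually_side_pos σ ts] with t ht hpos
    have := Real.rpow_pos_of_pos hpos p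
    rw [hg, Complex.norm_real, abs_sub_eq_mul hσ hpos, Real.norm_of_nonneg (by linarith),
      Real.norm_of_nonneg this.le]
    exact ht.2
  · refine IsBigO.of_bound 1 ?_
    filter_upwards [h, eventually_side_pos σ ts] with t ht hpos
    have := Real.rpow_pos_of_pos hpos p
    rw [hg, Complex.norm_real, abs_sub_eq_mul hσ hpos, Real.norm_of_nonneg this.le, one_mul,
      Real.norm_of_nonneg (by linarith)]
    exact ht.1

/-- Used to absorb the terms of higher order in `s` into the leading power. -/
lemma eventually_le_rpow (σ ts : ℝ) {ω : ℕ} (hω : 1 ≤ ω) :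
    ∀ᶠ t in side σ ts, σ * (t - ts) ≤ (σ * (t - ts)) ^ (1 / (ω : ℝ)) := by
  have hs : Tendsto (fun t => σ * (t - ts)) (side σ ts) (𝓝 0) :=
    (tendsto_mul_sub_side σ ts).mono_right nhdsWithin_le_nhds
  filter_upwards [hs.eventually (eventually_lt_nhds one_pos), eventually_side_pos σ ts]
    with t h1 hpos
  refine Real.self_le_rpow_of_le_one hpos.le h1.le ?_
  rw [div_le_one (by exact_mod_cast hω)]
  exact_mod_cast hω

lemma exists_worst_case (ts : ℝ) (σ : ℝ) (hσ : σ = 1 ∨ σ = -1) (ω : ℕ) (hω : 1 ≤ ω) :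
    ∃ (n m : ℕ) (f : Fin n → MvPolynomial (Fin n ⊕ Fin m) ℂ) (lam0 lam1 : Fin m → ℂ)
        (xs : Fin n → ℂ) (ls : Fin m → ℂ) (x : ℝ → Fin n → ℂ) (lam : ℝ → Fin m → ℂ)
        (y : ℝ → Fin n → ℂ) (k : Fin n ⊕ Fin m) (j : Fin n),
        IsIsolatedSingularSolution f lam0 lam1 ts xs ls ∧
        IsSolutionPath f lam0 lam1 σ ts x lam xs ls ∧
        HasWindingNumber σ ts x ω ∧
        dhval f lam0 lam1 k j xs ls (ts : ℂ) = 0 ∧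
        (fun t => dhval f lam0 lam1 k j (x t) (lam t) (t : ℂ))
          =Θ[side σ ts] (fun t => |t - ts| ^ (1 / (ω : ℝ))) ∧
        (fun t => y t - x t) =O[side σ ts] (fun t => t - ts) ∧
        (fun t => hval f lam0 lam1 k (y t) (lam t) (t : ℂ))
          =Θ[side σ ts] (fun t => |t - ts| ^ (((ω : ℝ) + 1) / (ω : ℝ))) ∧
        (fun t => dhval f lam0 lam1 k j (y t) (lam t) (t : ℂ))
          =Θ[side σ ts] (fun t => |t - ts| ^ (1 / (ω : ℝ))) := by
  have hω0 : ω ≠ 0 := by omega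
  have hωr : (ω : ℝ) ≠ 0 := by exact_mod_cast hω0
  -- These endpoints make the parameter equal `σ * (t - ts)`, hence zero at `ts` and positive on the
  -- chosen side.
  set lam0 : Fin 1 → ℂ := fun _ => -(σ * ts : ℂ) with hl0
  set lam1 : Fin 1 → ℂ := fun _ => (σ * (1 - ts) : ℂ) with hl1
  have hline : ∀ t : ℝ, paramLine lam0 lam1 t = fun _ => ((σ * (t - ts) : ℝ) : ℂ) := fun t => by
    funext i
    simp [paramLine, hl0, hl1]
    ring
  have hinr : ∀ (i : Fin 1) x lam (t : ℝ), hval (branchSystem ω) lam0 lam1 (Sum.inr i) x lam t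
      = lam i - ((σ * (t - ts) : ℝ) : ℂ) := fun i x lam t => by rw [hval_inr, hline]
  refine ⟨2, 1, branchSystem ω, lam0, lam1, 0, 0, branchPath σ ts 0 ω,
    fun t _ => ((σ * (t - ts) : ℝ) : ℂ), branchPath σ ts 1 ω, Sum.inl 1, 1,
    ⟨?_, Eventually.of_forall ?_, jacobian_branchSystem_rank ω 0⟩, ⟨?_, tendsto_branchPath σ ts 0 hω, ?_⟩,
    branchPath_hasWindingNumber ts hσ hω, ?_, ?_, ?_, ?_, ?_⟩
  · rintro (k | i)
    · fin_cases k
      · simp [hval_branchSystem_zero, hω0]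
      · simp [hval_branchSystem_one]
    · simp [hinr]
  · rintro ⟨x, lam⟩ h
    have hlam : lam = 0 := by
      funext i
      simpa [hinr] using h (Sum.inr i)
    have h0 : x 0 = 0 := by
      simpa [hval_branchSystem_zero, hlam, hω0] using h (Sum.inl 0)
    have h1 : x 1 = 0 := by
      simpa [hval_branchSystem_one, h0] using h (Sum.inl 1)
    have hx : x = 0 := by
      funext j
      fin_cases j
      exacts [h0, h1]
    rw [hx, hlam]
  · filter_upwards [eventually_side_pos σ ts] with t hpos
    rintro (k | i)
    · fin_cases k
      · have : ((σ * (t - ts)) ^ (1 / (ω : ℝ))) ^ ω = σ * (t - ts) := by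
          rw [one_div, Real.rpow_inv_natCast_pow hpos.le hω0]
        simp only [Fin.zero_eta, hval_branchSystem_zero, branchPath, Matrix.cons_val_zero]
        rw [← Complex.ofReal_pow, this, sub_self]
      · simp [hval_branchSystem_one, branchPath]
    · simp [hinr]
  · refine tendsto_pi_nhds.2 fun _ => ?_
    simpa [Function.comp_def] using (Complex.continuous_ofReal.tendsto 0).comp
      ((tendsto_mul_sub_side σ ts).mono_right nhdsWithin_le_nhds)
  · simp [dhval_branchSystem]
  · refine isTheta_of_bounds (C := 1) hσ (a := fun t => (σ * (t - ts)) ^ (1 / (ω : ℝ)))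
      (fun t => by simp [dhval_branchSystem, branchPath]) (Eventually.of_forall fun t => ?_)
    simp
  · refine isBigO_pi.2 fun j => IsBigO.of_bound 1 (Eventually.of_forall fun t => ?_)
    fin_cases j
    · simp [branchPath]
    · have : (branchPath σ ts 1 ω t - branchPath σ ts 0 ω t) 1 = ((σ * (t - ts) : ℝ) : ℂ) := by
        simp [branchPath]
      refine (congrArg norm this).trans_le ?_
      rw [Complex.norm_real]
      rcases hσ with rfl | rfl <;> simp [abs_sub_comm]
  -- As `s ≤ s ^ (1 / ω)`, the term `s ^ 2` costs at most one more copy of `s ^ (1 / ω) * s`.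
  · refine isTheta_of_bounds (C := 2) hσ (a := fun t => (σ * (t - ts)) ^ (1 / (ω : ℝ)) *
      (σ * (t - ts)) + (σ * (t - ts)) ^ 2)
      (fun t => by simp [hval_branchSystem_one, branchPath]) ?_
    filter_upwards [eventually_side_pos σ ts, eventually_le_rpow σ ts hω] with t hpos hle
    have : (σ * (t - ts)) ^ (((ω : ℝ) + 1) / ω) =
        (σ * (t - ts)) ^ (1 / (ω : ℝ)) * (σ * (t - ts)) := by
      rw [add_div, div_self hωr, add_comm, Real.rpow_add hpos, Real.rpow_one]
    rw [this]
    constructor <;> nlinarith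
  -- Likewise `2 s ≤ 2 s ^ (1 / ω)`.
  · refine isTheta_of_bounds (C := 3) hσ (a := fun t => (σ * (t - ts)) ^ (1 / (ω : ℝ)) +
      2 * (σ * (t - ts)))
      (fun t => by simp [dhval_branchSystem, branchPath]) ?_
    filter_upwards [eventually_side_pos σ ts, eventually_le_rpow σ ts hω] with t hpos hle
    constructor <;> linarith

end Sweep

theorem proposition1 (ts : ℝ) (hts : ts ∈ Set.Icc (0 : ℝ) 1) (σ : ℝ) (hσ : σ = 1 ∨ σ = -1)
    (ω : ℕ) (hω : 1 ≤ ω) :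
    -- the bound along every path, exact (`y = x`) or approximate
    (∀ (N n m : ℕ) (f : Fin N → MvPolynomial (Fin n ⊕ Fin m) ℂ) (lam0 lam1 : Fin m → ℂ)
        (xs : Fin n → ℂ) (ls : Fin m → ℂ) (x : ℝ → Fin n → ℂ) (lam : ℝ → Fin m → ℂ),
        Sweep.IsIsolatedSingularSolution f lam0 lam1 ts xs ls →
        Sweep.IsSolutionPath f lam0 lam1 σ ts x lam xs ls →
        Sweep.HasWindingNumber σ ts x ω →
        ∀ y : ℝ → Fin n → ℂ,
          (fun t => y t - x t) =O[Sweep.side σ ts] (fun t => |t - ts| ^ (1 / (ω : ℝ))) →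
          ∀ (k : Fin N ⊕ Fin m) (j : Fin n),
            (fun t => Sweep.hval f lam0 lam1 k (y t) (lam t) (t : ℂ))
              =O[Sweep.side σ ts] (fun t => t - ts) →
            Sweep.dhval f lam0 lam1 k j xs ls (ts : ℂ) = 0 →
            (fun t => Sweep.dhval f lam0 lam1 k j (y t) (lam t) (t : ℂ))
              =O[Sweep.side σ ts] (fun t => |t - ts| ^ (1 / (ω : ℝ)))) ∧
    -- the worst case occurs, with exponents `(ω + 1) / ω` and `1 / ω`
    (∃ (n m : ℕ) (f : Fin n → MvPolynomial (Fin n ⊕ Fin m) ℂ) (lam0 lam1 : Fin m → ℂ)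
        (xs : Fin n → ℂ) (ls : Fin m → ℂ) (x : ℝ → Fin n → ℂ) (lam : ℝ → Fin m → ℂ)
        (y : ℝ → Fin n → ℂ) (k : Fin n ⊕ Fin m) (j : Fin n),
        Sweep.IsIsolatedSingularSolution f lam0 lam1 ts xs ls ∧
        Sweep.IsSolutionPath f lam0 lam1 σ ts x lam xs ls ∧
        Sweep.HasWindingNumber σ ts x ω ∧
        Sweep.dhval f lam0 lam1 k j xs ls (ts : ℂ) = 0 ∧
        (fun t => Sweep.dhval f lam0 lam1 k j (x t) (lam t) (t : ℂ))
          =Θ[Sweep.side σ ts] (fun t => |t - ts| ^ (1 / (ω : ℝ))) ∧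
        (fun t => y t - x t) =O[Sweep.side σ ts] (fun t => t - ts) ∧
        (fun t => Sweep.hval f lam0 lam1 k (y t) (lam t) (t : ℂ))
          =Θ[Sweep.side σ ts] (fun t => |t - ts| ^ (((ω : ℝ) + 1) / (ω : ℝ))) ∧
        (fun t => Sweep.dhval f lam0 lam1 k j (y t) (lam t) (t : ℂ))
          =Θ[Sweep.side σ ts] (fun t => |t - ts| ^ (1 / (ω : ℝ)))) := by
  exact ⟨fun N n m f lam0 lam1 xs ls x lam hs h hw y hy k j _ h0 =>
    Sweep.dhval_isBigO hσ hω hs h hw hy k j h0, Sweep.exists_worst_case ts σ hσ ω hω⟩
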